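/- Fix an integer $r\ge 2$. An $r$-graph is a finite hypergraph all of whose edges have exactly $r$ vertices; $v(H)$ and $e(H)$ denote its numbers of vertices and edges, and it is nontrivial if $e(H)\ge 2$. Its chromatic number is the least number of colors in a vertex coloring without monochromatic edges. For a family $\mathcal H$ of $r$-graphs, $m_k(\mathcal H)$ is the minimum number of edges in an $r$-graph with chromatic number greater than $k$ that contains no (not necessarily induced) copy of any member of $\mathcal H$. For a nontrivial $r$-graph $H$ let $\rho(H)=\max_{H'\subseteq H}\frac{e(H')-1}{v(H')-r}$, the maximum being over the nontrivial subhypergraphs $H'$ of $H$; $H$ is balanced if $\rho(H)=\frac{e(H)-1}{v(H)-r}$. **Theorem.** Let $\mathcal H=\{H_1,\dots,H_\ell\}$, $\ell\ge 1$, be a finite family of nontrivial balanced $r$-graphs, and put $e_i=e(H_i)$, $\rho_i=\rho(H_i)$, $\rho=\min_i\rho_i$ and $I=\{i:\rho_i=\rho\}$. Assume that $\rho>1/(r-1)$. For an edge $e$ of $H_i$ let $\alpha_i(e)$ be the number of automorphisms of $H_i$ that map $e$ to itself, and let $\alpha_i=\min_{e}\alpha_i(e)$. Then there is a unique positive real number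 $c_1$ with $$\sum_{i\in I}\frac{e_i c_1^{e_i-1}}{\alpha_i}=\frac{1}{50\,r!},$$ and $$c_2:=\max_{i\in I}\left(\frac{\alpha_i}{5e_ic_1^{e_i-1}r!}\right)^{1/(r-1)}\ \ge\ 10^{1/(r-1)} .$$ Moreover, for all sufficiently large $k$, $m_k(\mathcal H)$ is well defined (there is an $\mathcal H$-free $r$-graph with chromatic number greater than $k$) and $$m_k(\mathcal H)<c_{\mathcal H}\,\bigl(k^{r-1}\log k\bigr)^{\frac{r-1/\rho}{r-1-1/\rho}},$$ where $$c_{\mathcal H}=2\left(\frac{r!}{c_1}\right)^{\frac{1}{r-1-1/\rho}}c_2^{\frac{(r-1)(r-1/\rho)}{r-1-1/\rho}}\left(\frac{r-1}{r-1-1/\rho}\right)^{\frac{r-1/\rho}{r-1-1/\rho}} .$$ The factor $2$ in $c_{\mathcal H}$ may be replaced by any constant $C>1$ (with the threshold for $k$ then depending also on $C$). -/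

import Mathlib

open Filter

noncomputable section

namespace Hypergraph

/-- Every edge has exactly `r` vertices. A finite `Hypergraph` with this property is an `r`-graph. -/
def IsUniform {α : Type*} (H : Hypergraph α) (r : ℕ) : Prop :=
  ∀ e ∈ H.edgeSet, e.encard = r

/-- `H'` is a (not necessarily induced) subhypergraph of `H`. -/
def IsSub {α : Type*} (H' H : Hypergraph α) : Prop :=
  H'.vertexSet ⊆ H.vertexSet ∧ H'.edgeSet ⊆ H.edgeSet

/-- At least two edges. -/
def Nontrivial {α : Type*} (H : Hypergraph α) : Prop := H.edgeSet.Nontrivial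

/-- The number of vertices. -/
def numVerts {α : Type*} (H : Hypergraph α) : ℕ := H.vertexSet.ncard

/-- The number of edges. -/
def numEdges {α : Type*} (H : Hypergraph α) : ℕ := H.edgeSet.ncard

/-- The ratio `(e - 1) / (v - r)`. -/
def density {α : Type*} (r : ℕ) (H : Hypergraph α) : ℝ :=
  ((H.numEdges : ℝ) - 1) / ((H.numVerts : ℝ) - r)

/-- `ρ(H)`: the maximum of `(e' - 1) / (v' - r)` over the nontrivial subhypergraphs of `H`
(for finite nontrivial `H` the supremum is over a finite nonempty set). -/
def rho {α : Type*} (r : ℕ) (H : Hypergraph α) : ℝ :=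
  sSup {x : ℝ | ∃ H' : Hypergraph α, H'.IsSub H ∧ H'.Nontrivial ∧ x = H'.density r}

/-- The maximum defining `ρ(H)` is attained by `H` itself. -/
def IsBalanced {α : Type*} (r : ℕ) (H : Hypergraph α) : Prop :=
  H.rho r = H.density r

/-- A permutation of the vertices of `H` is an automorphism if it preserves edges and non-edges. -/
def IsAut {α : Type*} (H : Hypergraph α) (σ : Equiv.Perm H.vertexSet) : Prop :=
  ∀ e : Set H.vertexSet,
    Subtype.val '' (σ '' e) ∈ H.edgeSet ↔ Subtype.val '' e ∈ H.edgeSet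

/-- The number of automorphisms of `H` that map the edge `e` to itself (as a set). -/
def stabCount {α : Type*} (H : Hypergraph α) (e : Set α) : ℕ :=
  Nat.card {σ : Equiv.Perm H.vertexSet //
    H.IsAut σ ∧ Subtype.val '' (σ '' (Subtype.val ⁻¹' e)) = e}

/-- The minimum of `stabCount H e` over the edges `e` of `H`. -/
def minStab {α : Type*} (H : Hypergraph α) : ℕ :=
  sInf (H.stabCount '' H.edgeSet)

/-- `G` contains a (not necessarily induced) copy of `F`. -/
def Contains {α β : Type*} (G : Hypergraph β) (F : Hypergraph α) : Prop :=
  ∃ f : α → β, Set.InjOn f F.vertexSet ∧ (F.image f).IsSub G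

/-- There is a vertex colouring with `k` colours and without monochromatic edges. -/
def Colorable {α : Type*} (G : Hypergraph α) (k : ℕ) : Prop :=
  ∃ c : G.vertexSet → Fin k,
    ∀ e ∈ G.edgeSet, ¬ ∃ a : Fin k, ∀ v : G.vertexSet, (v : α) ∈ e → c v = a

/-- The least number of colours in a vertex colouring without monochromatic edges. -/
def chromaticNumber {α : Type*} (G : Hypergraph α) : ℕ∞ :=
  ⨅ k ∈ {k : ℕ | G.Colorable k}, (k : ℕ∞)

/-- The numbers of edges of the finite `r`-graphs that contain no member of the family `H`
and have chromatic number greater than `k`. -/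
def edgeCounts {ι : Type*} {α : ι → Type*} (r : ℕ) (H : ∀ i, Hypergraph (α i)) (k : ℕ) :
    Set ℕ :=
  {m : ℕ | ∃ (n : ℕ) (G : Hypergraph (Fin n)), G.IsUniform r ∧ (∀ i, ¬ G.Contains (H i)) ∧
    (k : ℕ∞) < G.chromaticNumber ∧ G.numEdges = m}

/-- `m_k(H)`: the minimum number of edges in an `H`-free `r`-graph of chromatic number greater
than `k`. (It is meaningful when `edgeCounts r H k` is nonempty.) -/
def minEdges {ι : Type*} {α : ι → Type*} (r : ℕ) (H : ∀ i, Hypergraph (α i)) (k : ℕ) : ℕ :=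
  sInf (edgeCounts r H k)

/-- `ρ` of a family: the minimum of `ρ(H i)`. -/
def familyRho {ι : Type*} {α : ι → Type*} (r : ℕ) (H : ∀ i, Hypergraph (α i)) : ℝ :=
  ⨅ i, (H i).rho r

open Classical in
/-- The indices `i` with `ρ(H i)` equal to the minimum. -/
def critical {ι : Type*} [Fintype ι] {α : ι → Type*} (r : ℕ) (H : ∀ i, Hypergraph (α i)) :
    Finset ι :=
  Finset.univ.filter fun i => (H i).rho r = familyRho r H

/-- `∑ e_i x ^ (e_i - 1) / α_i` over the critical indices `i`. -/
def criticalSum {ι : Type*} [Fintype ι] {α : ι → Type*} (r : ℕ) (H : ∀ i, Hypergraph (α i))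
    (x : ℝ) : ℝ :=
  ∑ i ∈ critical r H,
    ((H i).numEdges : ℝ) * x ^ ((H i).numEdges - 1) / ((H i).minStab : ℝ)

/-- The bound `C (r!/c₁)^{1/(r-1-1/ρ)} c₂^{(r-1)(r-1/ρ)/(r-1-1/ρ)}
((r-1)/(r-1-1/ρ))^{(r-1/ρ)/(r-1-1/ρ)} (k^{r-1} log k)^{(r-1/ρ)/(r-1-1/ρ)}`. -/
def edgeBound (C : ℝ) (r : ℕ) (ρ c₁ c₂ : ℝ) (k : ℕ) : ℝ :=
  C * ((r.factorial : ℝ) / c₁) ^ (1 / ((r : ℝ) - 1 - 1 / ρ))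
    * c₂ ^ (((r : ℝ) - 1) * ((r : ℝ) - 1 / ρ) / ((r : ℝ) - 1 - 1 / ρ))
    * (((r : ℝ) - 1) / ((r : ℝ) - 1 - 1 / ρ)) ^ (((r : ℝ) - 1 / ρ) / ((r : ℝ) - 1 - 1 / ρ))
    * ((k : ℝ) ^ (r - 1) * Real.log k) ^ (((r : ℝ) - 1 / ρ) / ((r : ℝ) - 1 - 1 / ρ))

end Hypergraph

end

/-
Take a random `r`-graph `G` with edge probability `p = c₁ n ^ (-1 / ρ)` on `n` vertices, where
`n ^ (r - 1 - 1 / ρ)` is a constant times `k ^ (r - 1) log k`, and delete the edges of a maximal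
packing of edge-disjoint copies of the forbidden hypergraphs. The result contains no copy, and it
is not `k`-colorable unless some set `S` of `s = n / k` vertices has become independent. In that
case all edges of `G` inside `S` are covered by a packing of copies, each with an edge inside `S`.
The copies of a packing appear independently, so a union bound over all packings shows that this
has probability at most `(1 - p) ^ N * exp (∑ A, (p / (1 - p)) ^ |A|)`, where `N = s.choose r` and
`A` runs over all copies with an edge inside `S`. By the choice of `c₁` the sum is less than
`p N / 10`, the noncritical hypergraphs contributing `o (p N)`, and by the choice of `c₂` the
product `p N` is at least `2 s log n`. So the union bound over all `S` succeeds, and Markov's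
inequality bounds the number of edges.
-/

namespace RandomSubset

open Finset MeasureTheory ProbabilityTheory
open scoped unitInterval

variable {E : Type*}

section Bernoulli

variable {U A B : Finset E} {p : I}

lemma setBernoulli_real_subset_and_disjoint (hA : A ⊆ U) (hB : B ⊆ U) (hAB : Disjoint A B) :
    setBer(U, p).real {G : Set E | ↑A ⊆ G ∧ Disjoint ↑B G} = p ^ #A * (1 - p : ℝ) ^ #B := by
  classical
  have hcyl : (fun P : E → Prop ↦ {e | P e}) ⁻¹' {G : Set E | ↑A ⊆ G ∧ Disjoint ↑B G} =
      Set.pi ↑(A ∪ B) fun e ↦ if e ∈ A then {True} else {False} := by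
    ext P
    simp only [Set.mem_preimage, Set.mem_ofPred_eq, Set.disjoint_left, Set.mem_pi, coe_union,
      Set.mem_union, or_imp, forall_and, Set.subset_def, mem_coe]
    refine and_congr (forall₂_congr fun e he ↦ ?_) (forall₂_congr fun e he ↦ ?_)
    · simp [he]
    · simp [disjoint_right.1 hAB he]
  rw [measureReal_def, setBernoulli_apply', hcyl,
    Measure.infinitePi_pi _ fun e _ ↦ MeasurableSet.of_discrete, ENNReal.toReal_prod,
    prod_union hAB, ← prod_const, ← prod_const]
  congr 1
  · exact prod_congr rfl fun e he ↦ by simp [he, hA he]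
  · exact prod_congr rfl fun e he ↦ by simp [disjoint_right.1 hAB he, hB he]

lemma setBernoulli_real_mem {e : E} (he : e ∈ U) : setBer(U, p).real {G | e ∈ G} = p := by
  simpa using setBernoulli_real_subset_and_disjoint (p := p) (singleton_subset_iff.2 he)
    (empty_subset U) (disjoint_empty_right {e})

open Classical in
lemma setBernoulli_real_le_card_le (U : Finset E) (p : I) {m : ℝ} (hm : 0 < m) :
    setBer(U, p).real {G | m ≤ #{e ∈ U | e ∈ G}} ≤ p * #U / m := by
  have hcard : ∀ G : Set E, (#{e ∈ U | e ∈ G} : ℝ) =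
      ∑ e ∈ U, Set.indicator {G : Set E | e ∈ G} 1 G := fun G ↦ by simp [Set.indicator_apply]
  have hmeas : ∀ e : E, MeasurableSet {G : Set E | e ∈ G} := fun e ↦ (measurable_set_mem e).setOf
  have hint : ∀ e ∈ U, Integrable (Set.indicator {G : Set E | e ∈ G} (1 : Set E → ℝ))
      setBer(U, p) := fun e _ ↦ (integrable_const 1).indicator (hmeas e)
  have hmean : ∫ G, (#{e ∈ U | e ∈ G} : ℝ) ∂setBer(U, p) = p * #U := by
    simp_rw [hcard]
    rw [integral_finsetSum U hint, sum_congr rfl fun e he ↦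
      (integral_indicator_one (hmeas e)).trans (setBernoulli_real_mem he), sum_const,
      nsmul_eq_mul, mul_comm]
  rw [le_div_iff₀' hm, ← hmean]
  exact mul_meas_ge_le_integral_of_nonneg (.of_forall fun G ↦ Nat.cast_nonneg _)
    (by simpa only [hcard] using integrable_finsetSum U hint) m

end Bernoulli

variable [DecidableEq E]

/-- A packing `F` in `G`: pairwise disjoint sets, all of them contained in `G`. -/
structure IsPacking (F : Finset (Finset E)) (G : Set E) : Prop where
  pairwiseDisjoint : (F : Set (Finset E)).PairwiseDisjoint id
  biUnion_subset : ↑(F.biUnion id) ⊆ G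

lemma exists_isPacking_maximal {𝒞 : Finset (Finset E)} (hne : ∀ A ∈ 𝒞, A.Nonempty) (G : Set E) :
    ∃ F ⊆ 𝒞, IsPacking F G ∧ ∀ A ∈ 𝒞, ¬ (A : Set E) ⊆ G \ ↑(F.biUnion id) := by
  classical
  obtain ⟨F, hF, hmax⟩ := exists_maximal (s := {F ∈ 𝒞.powerset | IsPacking F G})
    ⟨∅, by simpa using ⟨by simp, by simp⟩⟩
  simp only [mem_filter, mem_powerset] at hF hmax
  obtain ⟨hF𝒞, hFG⟩ := hF
  refine ⟨F, hF𝒞, hFG, fun A hA hAG ↦ ?_⟩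
  have hdisj : ∀ A' ∈ F, Disjoint A A' := fun A' hA' ↦ disjoint_left.2 fun x hx hx' ↦
    (hAG hx).2 (mem_biUnion.2 ⟨A', hA', hx'⟩)
  have hins : IsPacking (insert A F) G := by
    refine ⟨?_, ?_⟩
    · rw [coe_insert]
      exact hFG.pairwiseDisjoint.insert fun A' hA' _ ↦ hdisj A' hA'
    · rw [biUnion_insert, coe_union]
      exact Set.union_subset (hAG.trans Set.sdiff_subset) hFG.biUnion_subset
  have hAF := hmax ⟨insert_subset hA hF𝒞, hins⟩ (subset_insert A F) (mem_insert_self A F)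
  exact (hne A hA).ne_empty (disjoint_self.1 (hdisj A hAF))

lemma setBernoulli_real_isPacking_le {U B : Finset E} {F : Finset (Finset E)} {p : I}
    (hp : p < 1) (hF : ∀ A ∈ F, A ⊆ U) (hB : B ⊆ U) :
    setBer(U, p).real {G : Set E | IsPacking F G ∧ G ∩ ↑B ⊆ ↑(F.biUnion id)} ≤
      (1 - p : ℝ) ^ #B * ∏ A ∈ F, (p / (1 - p) : ℝ) ^ #A := by
  have hp' : (0 : ℝ) < 1 - p := sub_pos.2 hp
  by_cases hd : (F : Set (Finset E)).PairwiseDisjoint id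
  swap
  · have hempty : {G : Set E | IsPacking F G ∧ G ∩ ↑B ⊆ ↑(F.biUnion id)} = ∅ :=
      Set.eq_empty_of_forall_notMem fun G hG ↦ hd hG.1.pairwiseDisjoint
    rw [hempty, measureReal_empty]
    exact mul_nonneg (pow_nonneg hp'.le _)
      (prod_nonneg fun _ _ ↦ pow_nonneg (div_nonneg p.2.1 hp'.le) _)
  rw [prod_pow_eq_pow_sum, ← show #(F.biUnion id) = ∑ A ∈ F, #A from card_biUnion hd]
  have hX : F.biUnion id ⊆ U := biUnion_subset.2 hF
  have hset : {G : Set E | IsPacking F G ∧ G ∩ ↑B ⊆ ↑(F.biUnion id)} ⊆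
      {G : Set E | ↑(F.biUnion id) ⊆ G ∧ Disjoint ↑(B \ F.biUnion id) G} :=
    fun G ⟨hFG, hcov⟩ ↦ ⟨hFG.biUnion_subset, Set.disjoint_left.2 fun e he heG ↦
      (Finset.mem_sdiff.1 he).2 (hcov ⟨heG, (Finset.mem_sdiff.1 he).1⟩)⟩
  refine (measureReal_mono hset).trans ?_
  rw [setBernoulli_real_subset_and_disjoint hX (sdiff_subset.trans hB) disjoint_sdiff]
  set X := F.biUnion id
  have hcard : (1 - p : ℝ) ^ #(B \ X) * (1 - p) ^ #X ≤ (1 - p) ^ #B := by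
    rw [← pow_add]
    refine pow_le_pow_of_le_one hp'.le (by linarith [p.2.1]) ?_
    have := le_card_sdiff X B
    omega
  rw [div_pow, mul_div_assoc', le_div_iff₀ (pow_pos hp' _), mul_assoc, mul_comm]
  exact mul_le_mul_of_nonneg_right hcard (pow_nonneg p.2.1 _)

lemma setBernoulli_real_exists_isPacking_le {U B : Finset E} {𝒞 : Finset (Finset E)} {p : I}
    (hp : p < 1) (h𝒞 : ∀ A ∈ 𝒞, A ⊆ U) (hB : B ⊆ U) :
    setBer(U, p).real {G : Set E | ∃ F ⊆ 𝒞, IsPacking F G ∧ G ∩ ↑B ⊆ ↑(F.biUnion id)} ≤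
      (1 - p : ℝ) ^ #B * Real.exp (∑ A ∈ 𝒞, (p / (1 - p) : ℝ) ^ #A) := by
  have hp' : (0 : ℝ) < 1 - p := sub_pos.2 hp
  have hq : (0 : ℝ) ≤ p / (1 - p) := div_nonneg p.2.1 hp'.le
  have hunion : {G : Set E | ∃ F ⊆ 𝒞, IsPacking F G ∧ G ∩ ↑B ⊆ ↑(F.biUnion id)} =
      ⋃ F ∈ 𝒞.powerset, {G | IsPacking F G ∧ G ∩ ↑B ⊆ ↑(F.biUnion id)} := by
    ext G
    simp only [Set.mem_ofPred_eq, Set.mem_iUnion, mem_powerset, exists_prop]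
  calc _ ≤ ∑ F ∈ 𝒞.powerset, (1 - p : ℝ) ^ #B * ∏ A ∈ F, (p / (1 - p) : ℝ) ^ #A := by
        rw [hunion]
        refine (measureReal_biUnion_finset_le _ _).trans (sum_le_sum fun F hF ↦ ?_)
        exact setBernoulli_real_isPacking_le hp (fun A hA ↦ h𝒞 A (mem_powerset.1 hF hA)) hB
    _ = (1 - p : ℝ) ^ #B * ∏ A ∈ 𝒞, (1 + (p / (1 - p) : ℝ) ^ #A) := by
        rw [← mul_sum, prod_one_add]
    _ ≤ _ := by
        rw [Real.exp_sum]
        refine mul_le_mul_of_nonneg_left (prod_le_prod (fun _ _ ↦ by positivity) fun A _ ↦ ?_)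
          (pow_nonneg hp'.le _)
        rw [add_comm]
        exact Real.add_one_le_exp _

open Classical in
lemma exists_packing_or_exists_free_transversal {U : Finset E} {𝒞 ℬ : Finset (Finset E)}
    (hne : ∀ A ∈ 𝒞, A.Nonempty) (hℬ : ∀ B ∈ ℬ, B ⊆ U) (G : Set E) :
    (∃ B ∈ ℬ, ∃ F ⊆ {A ∈ 𝒞 | ¬ Disjoint A B},
        IsPacking F G ∧ G ∩ ↑B ⊆ ↑(F.biUnion id)) ∨
      ∃ T ⊆ U.filter (· ∈ G), (∀ A ∈ 𝒞, ¬ A ⊆ T) ∧ ∀ B ∈ ℬ, ¬ Disjoint T B := by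
  obtain ⟨F, hF𝒞, hFG, hfree⟩ := exists_isPacking_maximal hne G
  rw [or_iff_not_imp_left]
  intro hcov
  refine ⟨{e ∈ U | e ∈ G} \ F.biUnion id, sdiff_subset, fun A hA hAT ↦ hfree A hA fun e he ↦ ?_,
    fun B hB hdisj ↦ hcov ⟨B, hB, {A ∈ F | ¬ Disjoint A B}, filter_subset_filter _ hF𝒞,
      ⟨hFG.1.subset (coe_subset.2 (filter_subset _ _)), ?_⟩, fun e ⟨heG, heB⟩ ↦ ?_⟩⟩
  · obtain ⟨heG, heF⟩ := Finset.mem_sdiff.1 (hAT he)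
    exact ⟨(mem_filter.1 heG).2, heF⟩
  · exact (coe_subset.2 (biUnion_subset_biUnion_of_subset_left _ (filter_subset _ _))).trans
      hFG.2
  · have heF : e ∈ F.biUnion id := by
      by_contra heF
      exact disjoint_right.1 hdisj heB
        (Finset.mem_sdiff.2 ⟨mem_filter.2 ⟨hℬ B hB heB, heG⟩, heF⟩)
    obtain ⟨A, hA, heA⟩ := mem_biUnion.1 heF
    exact mem_biUnion.2 ⟨A, mem_filter.2 ⟨hA, not_disjoint_iff.2 ⟨e, heA, heB⟩⟩, heA⟩

theorem exists_free_transversal {U : Finset E} {𝒞 ℬ : Finset (Finset E)}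
    (h𝒞 : ∀ A ∈ 𝒞, A ⊆ U) (hne : ∀ A ∈ 𝒞, A.Nonempty) (hℬ : ∀ B ∈ ℬ, B ⊆ U)
    {p : I} (hp : p < 1) {m : ℝ} (hm : 0 < m)
    (h : ∑ B ∈ ℬ, (1 - p : ℝ) ^ #B *
      Real.exp (∑ A ∈ 𝒞 with ¬ Disjoint A B, (p / (1 - p) : ℝ) ^ #A) + p * #U / m < 1) :
    ∃ T ⊆ U, (∀ A ∈ 𝒞, ¬ A ⊆ T) ∧ (∀ B ∈ ℬ, ¬ Disjoint T B) ∧ (#T : ℝ) < m := by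
  classical
  by_contra! hlarge
  let covered (B : Finset E) : Set (Set E) := {G | ∃ F ⊆ {A ∈ 𝒞 | ¬ Disjoint A B},
    IsPacking F G ∧ G ∩ ↑B ⊆ ↑(F.biUnion id)}
  have hunion : (⋃ B ∈ ℬ, covered B) ∪ {G | m ≤ #{e ∈ U | e ∈ G}} = Set.univ := by
    refine Set.eq_univ_of_forall fun G ↦ ?_
    rcases exists_packing_or_exists_free_transversal hne hℬ G with ⟨B, hB, hG⟩ | ⟨T, hT, hT'⟩
    · exact .inl (Set.mem_biUnion hB hG)
    · exact .inr ((hlarge T (hT.trans (filter_subset _ _)) hT'.1 hT'.2).trans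
        (by exact_mod_cast card_le_card hT))
  refine h.not_ge ?_
  calc (1 : ℝ) = setBer(U, p).real ((⋃ B ∈ ℬ, covered B) ∪ {G | m ≤ #{e ∈ U | e ∈ G}}) := by
        rw [hunion, probReal_univ]
    _ ≤ ∑ B ∈ ℬ, setBer(U, p).real (covered B) +
          setBer(U, p).real {G | m ≤ #{e ∈ U | e ∈ G}} :=
        (measureReal_union_le _ _).trans
          (add_le_add_left (measureReal_biUnion_finset_le ℬ covered) _)
    _ ≤ _ := add_le_add (sum_le_sum fun B hB ↦ setBernoulli_real_exists_isPacking_le hp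
          (fun A hA ↦ h𝒞 A (mem_filter.1 hA).1) (hℬ B hB)) (setBernoulli_real_le_card_le U p hm)

end RandomSubset

namespace FreeHypergraph

open Finset Hypergraph Topology Asymptotics

section Copies

variable {V W : Type*} [Fintype V] [Fintype W] [DecidableEq W]

/-- The edge sets of the copies, in the complete hypergraph on `W`, of the hypergraph with vertex
set `V` and edge set `𝓔`. -/
noncomputable def copies (W : Type*) [Fintype W] [DecidableEq W] (𝓔 : Finset (Finset V)) :
    Finset (Finset (Finset W)) :=
  univ.image fun f : V ↪ W ↦ 𝓔.image fun e ↦ e.map f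

/-- The automorphisms of the hypergraph with edge set `𝓔` that map the vertex set `e` to
itself. -/
def edgeStabilizer [DecidableEq V] (𝓔 : Finset (Finset V)) (e : Finset V) :
    Finset (Equiv.Perm V) :=
  {σ | (𝓔.image fun e' ↦ e'.map σ.toEmbedding) = 𝓔 ∧ e.map σ.toEmbedding = e}

lemma card_of_mem_copies {𝓔 : Finset (Finset V)} {A : Finset (Finset W)}
    (hA : A ∈ copies W 𝓔) : #A = #𝓔 := by
  obtain ⟨f, -, rfl⟩ := mem_image.1 hA
  exact card_image_of_injective _ (Finset.map_injective f)

lemma mem_powersetCard_of_mem_copies {r : ℕ} {𝓔 : Finset (Finset V)} (h𝓔 : ∀ e ∈ 𝓔, #e = r)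
    {A : Finset (Finset W)} (hA : A ∈ copies W 𝓔) : A ⊆ powersetCard r univ := by
  obtain ⟨f, -, rfl⟩ := mem_image.1 hA
  refine image_subset_iff.2 fun e he ↦ mem_powersetCard_univ.2 ?_
  rw [card_map, h𝓔 e he]

lemma card_embedding_map_eq_le (e : Finset V) (R : Finset W) :
    #{f : V ↪ W | e.map f = R} ≤ (#e).factorial * Fintype.card W ^ (Fintype.card V - #e) := by
  classical
  rcases (univ.filter fun f : V ↪ W ↦ e.map f = R).eq_empty_or_nonempty with h | ⟨f₀, hf₀⟩
  · rw [h, card_empty]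
    exact Nat.zero_le _
  have hR : #R = #e := by rw [← (mem_filter.1 hf₀).2, card_map]
  let restrict (f : {f : V ↪ W // e.map f = R}) : (e ↪ R) × ({x // x ∉ e} → W) :=
    (⟨fun x ↦ ⟨f.1 x, f.2.subset (mem_map_of_mem f.1 x.2)⟩,
      fun x y hxy ↦ Subtype.ext (f.1.injective (congrArg Subtype.val hxy))⟩, fun x ↦ f.1 x)
  have hinj : Function.Injective restrict := by
    intro f g hfg
    ext x
    by_cases hx : x ∈ e
    · exact congrArg Subtype.val (DFunLike.congr_fun (congrArg Prod.fst hfg) ⟨x, hx⟩)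
    · exact congrFun (congrArg Prod.snd hfg) ⟨x, hx⟩
  rw [← Fintype.card_subtype]
  refine (Fintype.card_le_of_injective restrict hinj).trans_eq ?_
  rw [Fintype.card_prod, Fintype.card_embedding_eq, Fintype.card_fun, Fintype.card_coe,
    Fintype.card_coe, hR, Nat.descFactorial_self, Fintype.card_subtype_compl, Fintype.card_coe]

variable [DecidableEq V]

lemma card_edgeStabilizer_le {𝓔 : Finset (Finset V)} {e : Finset V} (he : e ∈ 𝓔) (f : V ↪ W) :
    #(edgeStabilizer 𝓔 e) ≤ #{x ∈ 𝓔 ×ˢ (univ : Finset (V ↪ W)) |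
      x.1.map x.2 = e.map f ∧ 𝓔.image (·.map x.2) = 𝓔.image (·.map f)} := by
  refine card_le_card_of_injOn (fun σ ↦ (e, σ.toEmbedding.trans f)) (fun σ hσ ↦ ?_) ?_
  · obtain ⟨hσ𝓔, hσe⟩ := (mem_filter.1 hσ).2
    refine mem_coe.2 (mem_filter.2 ⟨mem_product.2 ⟨he, mem_univ _⟩, ?_, ?_⟩)
    · rw [← Finset.map_map, hσe]
    · conv_rhs => rw [← hσ𝓔, Finset.image_image]
      exact image_congr fun e' _ ↦ (Finset.map_map _ _ _).symm
  · intro σ _ τ _ h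
    ext x
    exact f.injective (DFunLike.congr_fun (Prod.mk.inj h).2 x)

lemma card_copies_mem_mul_le {r a : ℕ} {𝓔 : Finset (Finset V)} (h𝓔 : ∀ e ∈ 𝓔, #e = r)
    (ha : ∀ e ∈ 𝓔, a ≤ #(edgeStabilizer 𝓔 e)) (R : Finset W) :
    #{A ∈ copies W 𝓔 | R ∈ A} * a ≤
      #𝓔 * (r.factorial * Fintype.card W ^ (Fintype.card V - r)) := by
  let pairs : Finset (Finset V × (V ↪ W)) := {x ∈ 𝓔 ×ˢ univ | x.1.map x.2 = R}
  have hpairs : #pairs ≤ #𝓔 * (r.factorial * Fintype.card W ^ (Fintype.card V - r)) := by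
    rw [card_filter, sum_product]
    refine sum_le_card_nsmul _ _ _ fun e he ↦ ?_
    rw [← card_filter, ← h𝓔 e he]
    exact card_embedding_map_eq_le e R
  rw [mul_comm]
  refine (mul_card_image_le_card_of_maps_to (s := pairs) (f := fun x ↦ 𝓔.image (·.map x.2))
    (fun x hx ↦ ?_) a fun A hA ↦ ?_).trans hpairs
  · obtain ⟨hx, hxR⟩ := mem_filter.1 hx
    exact mem_filter.2 ⟨mem_image_of_mem _ (mem_univ x.2),
      mem_image.2 ⟨x.1, (mem_product.1 hx).1, hxR⟩⟩
  · obtain ⟨hA, hRA⟩ := mem_filter.1 hA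
    obtain ⟨f, -, rfl⟩ := mem_image.1 hA
    obtain ⟨e, he, rfl⟩ := mem_image.1 hRA
    rw [filter_filter]
    exact (ha e he).trans (card_edgeStabilizer_le he f)

end Copies

section EdgeFinset

variable {α : Type*} {H : Hypergraph α} [Fintype H.vertexSet] {r : ℕ}

open Classical in
variable (H) in
/-- The edges of a finite hypergraph as finite sets of elements of the vertex set, the form in
which its copies are counted. -/
noncomputable def edgeFinset : Finset (Finset H.vertexSet) :=
  {e | Subtype.val '' (e : Set H.vertexSet) ∈ H.edgeSet}

lemma mem_edgeFinset {e : Finset H.vertexSet} :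
    e ∈ edgeFinset H ↔ Subtype.val '' (e : Set H.vertexSet) ∈ H.edgeSet := by
  simp [edgeFinset]

lemma image_edgeFinset_eq_edgeSet :
    (fun e : Finset H.vertexSet ↦ Subtype.val '' (e : Set H.vertexSet)) '' ↑(edgeFinset H) =
      H.edgeSet := by
  classical
  refine Set.Subset.antisymm (Set.image_subset_iff.2 fun e he ↦ mem_edgeFinset.1 he) fun e he ↦ ?_
  have himage : Subtype.val '' ((Subtype.val ⁻¹' e : Set H.vertexSet).toFinset :
      Set H.vertexSet) = e := by
    rw [Set.coe_toFinset, Subtype.image_preimage_coe,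
      Set.inter_eq_right.2 (H.subset_vertexSet_of_mem_edgeSet he)]
  exact ⟨_, mem_edgeFinset.2 (himage.symm ▸ he), himage⟩

lemma card_edgeFinset : #(edgeFinset H) = H.numEdges := by
  have hinj : Function.Injective fun e : Finset H.vertexSet ↦
      Subtype.val '' (e : Set H.vertexSet) :=
    Subtype.val_injective.image_injective.comp coe_injective
  rw [numEdges, ← image_edgeFinset_eq_edgeSet, Set.ncard_image_of_injective _ hinj,
    Set.ncard_coe_finset]

lemma card_vertexSet : Fintype.card H.vertexSet = H.numVerts := by
  rw [numVerts, Set.ncard_eq_toFinset_card', Set.toFinset_card]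

lemma card_of_mem_edgeFinset (hH : H.IsUniform r) {e : Finset H.vertexSet}
    (he : e ∈ edgeFinset H) : #e = r := by
  have hcard := hH _ (mem_edgeFinset.1 he)
  rw [Subtype.val_injective.encard_image, Set.encard_coe_eq_coe_finsetCard] at hcard
  exact_mod_cast hcard

lemma image_edgeFinset_of_isAut [DecidableEq H.vertexSet] {σ : Equiv.Perm H.vertexSet}
    (hσ : H.IsAut σ) :
    ((edgeFinset H).image fun e ↦ e.map σ.toEmbedding) = edgeFinset H := by
  refine eq_of_subset_of_card_le (image_subset_iff.2 fun e he ↦ ?_)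
    (card_image_of_injective _ (Finset.map_injective _)).ge
  rw [mem_edgeFinset, coe_map]
  exact (hσ e).2 (mem_edgeFinset.1 he)

lemma minStab_le_card_edgeStabilizer [DecidableEq H.vertexSet] {e : Finset H.vertexSet}
    (he : e ∈ edgeFinset H) : H.minStab ≤ #(edgeStabilizer (edgeFinset H) e) := by
  classical
  refine (Nat.sInf_le (Set.mem_image_of_mem _ (mem_edgeFinset.1 he))).trans ?_
  rw [stabCount, Nat.card_eq_fintype_card, Fintype.card_subtype]
  refine card_le_card fun σ hσ ↦ ?_
  obtain ⟨haut, hfix⟩ := (mem_filter.1 hσ).2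
  rw [Set.preimage_image_eq _ Subtype.val_injective] at hfix
  refine mem_filter.2 ⟨mem_univ σ, image_edgeFinset_of_isAut haut, coe_injective ?_⟩
  rw [coe_map]
  exact Subtype.val_injective.image_injective hfix

end EdgeFinset

section MinStab

variable {α : Type*} {H : Hypergraph α} {r : ℕ}

lemma finite_edgeSet (hfin : H.vertexSet.Finite) :
    H.edgeSet.Finite :=
  hfin.finite_subsets.subset fun _ he ↦ H.subset_vertexSet_of_mem_edgeSet he

lemma minStab_pos (hfin : H.vertexSet.Finite) (hne : H.edgeSet.Nonempty) : 0 < H.minStab := by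
  have := hfin.to_subtype
  obtain ⟨e, he, hs⟩ := Nat.sInf_mem (hne.image H.stabCount)
  rw [minStab, ← hs, stabCount, Nat.card_pos_iff]
  refine ⟨⟨⟨1, fun e ↦ by simp, ?_⟩⟩, inferInstance⟩
  simp only [Equiv.Perm.coe_one, Set.image_id, Subtype.image_preimage_coe]
  exact Set.inter_eq_right.2 (H.subset_vertexSet_of_mem_edgeSet he)

/-- An upper bound for the number of copies of `H` in the complete `r`-graph on `n` vertices that
contain a given edge. -/
noncomputable def codegreeBound (r : ℕ) (H : Hypergraph α) (n : ℕ) : ℝ :=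
  H.numEdges * (r.factorial * (n : ℝ) ^ (H.numVerts - r)) / H.minStab

lemma card_copies_mem_le_codegreeBound [Fintype H.vertexSet] (hH : H.IsUniform r)
    (hne : H.edgeSet.Nonempty) {W : Type*} [Fintype W] [DecidableEq W] (R : Finset W) :
    (#{A ∈ copies W (edgeFinset H) | R ∈ A} : ℝ) ≤ codegreeBound r H (Fintype.card W) := by
  classical
  have hstab : (0 : ℝ) < H.minStab := by exact_mod_cast minStab_pos H.vertexSet.toFinite hne
  rw [codegreeBound, le_div_iff₀ hstab, ← card_edgeFinset, ← card_vertexSet]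
  exact_mod_cast card_copies_mem_mul_le (fun e he ↦ card_of_mem_edgeFinset hH he)
    (fun e he ↦ minStab_le_card_edgeStabilizer he) R

end MinStab

section OfEdges

variable {β : Type*} {G : Finset (Finset β)} {r : ℕ}

/-- The hypergraph on all of `β` with edge set `G`, used to turn a random set of edges into a
`Hypergraph`. -/
def ofEdges (G : Finset (Finset β)) : Hypergraph β where
  vertexSet := Set.univ
  edgeSet := (fun e : Finset β ↦ (e : Set β)) '' (G : Set (Finset β))
  subset_vertexSet_of_mem_edgeSet' := fun _ _ ↦ Set.subset_univ _

lemma numEdges_ofEdges (G : Finset (Finset β)) : (ofEdges G).numEdges = #G := by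
  rw [numEdges, ofEdges, Set.ncard_image_of_injective _ coe_injective, Set.ncard_coe_finset]

lemma isUniform_ofEdges (hG : ∀ e ∈ G, #e = r) : (ofEdges G).IsUniform r := by
  rintro _ ⟨e, he, rfl⟩
  rw [Set.encard_coe_eq_coe_finsetCard, hG e he]

lemma not_contains_ofEdges [Fintype β] [DecidableEq β] {α : Type*} {F : Hypergraph α}
    [Fintype F.vertexSet] (hG : ∀ A ∈ copies β (edgeFinset F), ¬ A ⊆ G) :
    ¬ (ofEdges G).Contains F := by
  rintro ⟨f, hf, -, hsub⟩
  let g : F.vertexSet ↪ β := ⟨fun v ↦ f v, fun v w hvw ↦ Subtype.ext (hf v.2 w.2 hvw)⟩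
  refine hG _ (mem_image_of_mem _ (mem_univ g)) (image_subset_iff.2 fun e he ↦ ?_)
  obtain ⟨e', he', heq⟩ := hsub (Set.mem_image_of_mem (Set.image f) (mem_edgeFinset.1 he))
  have hmap : e' = e.map g := coe_injective (by
    rw [coe_map]
    exact heq.trans (Set.image_image _ _ _))
  exact hmap ▸ he'

lemma not_colorable_ofEdges [Fintype β] [Nonempty β] {s k : ℕ} (hks : k * s ≤ Fintype.card β)
    (hG : ∀ S : Finset β, #S = s → ∃ e ∈ G, e ⊆ S) : ¬ (ofEdges G).Colorable k := by
  classical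
  rintro ⟨c, hc⟩
  let color (v : β) : Fin k := c ⟨v, Set.mem_univ v⟩
  have : Nonempty (Fin k) := ‹Nonempty β›.map color
  obtain ⟨a, ha⟩ := Fintype.exists_le_card_fiber_of_mul_le_card (n := s) color (by simpa using hks)
  obtain ⟨S, hS, hSs⟩ := exists_subset_card_eq ha
  obtain ⟨e, he, heS⟩ := hG S hSs
  exact hc _ ⟨e, he, rfl⟩ ⟨a, fun v hv ↦ (mem_filter.1 (hS (heS hv))).2⟩

lemma lt_chromaticNumber {G : Hypergraph β} {k : ℕ} (h : ∀ j ≤ k, ¬ G.Colorable j) :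
    (k : ℕ∞) < G.chromaticNumber := by
  refine (ENat.natCast_lt_natCast.2 k.lt_succ_self).trans_le (le_iInf₂ fun j hj ↦ ?_)
  exact Nat.cast_le.2 (not_le.1 fun hjk ↦ h j hjk hj)

end OfEdges

section Existence

open scoped unitInterval

variable {ι : Type*} {α : ι → Type*} {F : ∀ i, Hypergraph (α i)} {r : ℕ}

lemma card_mem_edgeCounts [∀ i, Fintype (F i).vertexSet] {n s k : ℕ} (hn : 0 < n)
    (hks : k * s ≤ n) {G : Finset (Finset (Fin n))} (hG : G ⊆ powersetCard r univ)
    (hfree : ∀ i, ∀ A ∈ copies (Fin n) (edgeFinset (F i)), ¬ A ⊆ G)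
    (htrans : ∀ S : Finset (Fin n), #S = s → ∃ e ∈ G, e ⊆ S) : #G ∈ edgeCounts r F k := by
  have : Nonempty (Fin n) := ⟨⟨0, hn⟩⟩
  refine ⟨n, ofEdges G, isUniform_ofEdges fun e he ↦ (mem_powersetCard.1 (hG he)).2,
    fun i ↦ not_contains_ofEdges (hfree i), lt_chromaticNumber fun j hj ↦ ?_, numEdges_ofEdges G⟩
  refine not_colorable_ofEdges (s := s) ?_ htrans
  rw [Fintype.card_fin]
  exact (Nat.mul_le_mul_right s hj).trans hks

lemma sum_biUnion_le {κ E : Type*} [DecidableEq E] (s : Finset κ) (t : κ → Finset E) {f : E → ℝ}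
    (hf : ∀ x, 0 ≤ f x) : ∑ x ∈ s.biUnion t, f x ≤ ∑ i ∈ s, ∑ x ∈ t i, f x := by
  classical
  induction s using Finset.induction_on with
  | empty => simp
  | insert i s hi ih =>
    rw [biUnion_insert, sum_insert hi]
    have hunion := sum_union_inter (s₁ := t i) (s₂ := s.biUnion t) (f := f)
    have hinter : 0 ≤ ∑ x ∈ t i ∩ s.biUnion t, f x := sum_nonneg fun x _ ↦ hf x
    linarith

variable {W : Type*} [Fintype W] [DecidableEq W]

lemma sum_copies_not_disjoint_le {α : Type*} {H : Hypergraph α} [Fintype H.vertexSet]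
    (hH : H.IsUniform r) (hne : H.edgeSet.Nonempty) (B : Finset (Finset W)) {q : ℝ}
    (hq : 0 ≤ q) :
    ∑ A ∈ copies W (edgeFinset H) with ¬ Disjoint A B, q ^ #A ≤
      #B * (codegreeBound r H (Fintype.card W) * q ^ H.numEdges) := by
  have hsub : {A ∈ copies W (edgeFinset H) | ¬ Disjoint A B} ⊆
      B.biUnion fun R ↦ {A ∈ copies W (edgeFinset H) | R ∈ A} := fun A hA ↦ by
    obtain ⟨hA, hAB⟩ := mem_filter.1 hA
    obtain ⟨R, hRA, hRB⟩ := not_disjoint_iff.1 hAB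
    exact mem_biUnion.2 ⟨R, hRB, mem_filter.2 ⟨hA, hRA⟩⟩
  refine (sum_le_sum_of_subset_of_nonneg hsub fun _ _ _ ↦ pow_nonneg hq _).trans ?_
  refine (sum_biUnion_le _ _ fun _ ↦ pow_nonneg hq _).trans ?_
  rw [← nsmul_eq_mul]
  refine sum_le_card_nsmul _ _ _ fun R _ ↦ ?_
  rw [sum_congr rfl fun A hA ↦ by
    rw [card_of_mem_copies (mem_filter.1 hA).1, card_edgeFinset], sum_const, nsmul_eq_mul]
  exact mul_le_mul_of_nonneg_right (card_copies_mem_le_codegreeBound hH hne R) (pow_nonneg hq _)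

lemma sum_biUnion_copies_not_disjoint_le [Fintype ι] [∀ i, Fintype (F i).vertexSet]
    (hunif : ∀ i, (F i).IsUniform r) (hne : ∀ i, (F i).edgeSet.Nonempty)
    (B : Finset (Finset W)) {q : ℝ} (hq : 0 ≤ q) :
    ∑ A ∈ univ.biUnion fun i ↦ copies W (edgeFinset (F i)) with ¬ Disjoint A B, q ^ #A ≤
      #B * ∑ i, codegreeBound r (F i) (Fintype.card W) * q ^ (F i).numEdges := by
  rw [filter_biUnion, mul_sum]
  exact (sum_biUnion_le _ _ fun _ ↦ pow_nonneg hq _).trans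
    (sum_le_sum fun i _ ↦ sum_copies_not_disjoint_le (hunif i) (hne i) B hq)

theorem exists_mem_edgeCounts_lt [Fintype ι] (hfin : ∀ i, (F i).vertexSet.Finite)
    (hunif : ∀ i, (F i).IsUniform r) (hne : ∀ i, (F i).edgeSet.Nonempty) {n s k : ℕ}
    (hn : 0 < n) (hks : k * s ≤ n) {p : I} (hp : p < 1) {m : ℝ} (hm : 0 < m)
    (h : n.choose s * ((1 - p : ℝ) ^ s.choose r * Real.exp (s.choose r *
      ∑ i, codegreeBound r (F i) n * (p / (1 - p) : ℝ) ^ (F i).numEdges)) +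
        p * n.choose r / m < 1) :
    ∃ x ∈ edgeCounts r F k, (x : ℝ) < m := by
  classical
  have := fun i ↦ (hfin i).fintype
  have hp' : (0 : ℝ) < 1 - p := sub_pos.2 hp
  let 𝒞 := univ.biUnion fun i ↦ copies (Fin n) (edgeFinset (F i))
  let ℬ : Finset (Finset (Finset (Fin n))) := (powersetCard s univ).image (powersetCard r)
  have h𝒞 : ∀ A ∈ 𝒞, A ⊆ powersetCard r univ ∧ A.Nonempty := fun A hA ↦ by
    obtain ⟨i, -, hi⟩ := mem_biUnion.1 hA
    refine ⟨mem_powersetCard_of_mem_copies (fun e he ↦ card_of_mem_edgeFinset (hunif i) he) hi, ?_⟩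
    rw [← card_pos, card_of_mem_copies hi, card_edgeFinset]
    exact (Set.ncard_pos (finite_edgeSet (hfin i))).2 (hne i)
  have hℬ : ∀ B ∈ ℬ, B ⊆ powersetCard r univ ∧ #B = s.choose r := by
    refine forall_mem_image.2 fun S hS ↦ ⟨powersetCard_mono (subset_univ S), ?_⟩
    rw [card_powersetCard, mem_powersetCard_univ.1 hS]
  have hfail : ∑ B ∈ ℬ, (1 - p : ℝ) ^ #B *
      Real.exp (∑ A ∈ 𝒞 with ¬ Disjoint A B, (p / (1 - p) : ℝ) ^ #A) ≤
      n.choose s * ((1 - p : ℝ) ^ s.choose r * Real.exp (s.choose r *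
        ∑ i, codegreeBound r (F i) n * (p / (1 - p) : ℝ) ^ (F i).numEdges)) := by
    refine (sum_le_card_nsmul _ _ _ fun B hB ↦ ?_).trans
      ((nsmul_eq_mul _ _).trans_le (mul_le_mul_of_nonneg_right ?_
        (mul_nonneg (pow_nonneg hp'.le _) (Real.exp_pos _).le)))
    · have hcopies := sum_biUnion_copies_not_disjoint_le hunif hne B
        (div_nonneg p.2.1 hp'.le)
      rw [(hℬ B hB).2, Fintype.card_fin] at hcopies
      rw [(hℬ B hB).2]
      exact mul_le_mul_of_nonneg_left (Real.exp_le_exp.2 hcopies) (pow_nonneg hp'.le _)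
    · exact_mod_cast card_image_le.trans (by simp)
  obtain ⟨T, hTU, hfree, htrans, hTm⟩ := RandomSubset.exists_free_transversal
    (fun A hA ↦ (h𝒞 A hA).1) (fun A hA ↦ (h𝒞 A hA).2) (fun B hB ↦ (hℬ B hB).1) hp hm
    ((add_le_add hfail (by simp)).trans_lt h)
  refine ⟨#T, card_mem_edgeCounts hn hks hTU
    (fun i A hA ↦ hfree A (mem_biUnion.2 ⟨i, mem_univ i, hA⟩)) fun S hS ↦ ?_, hTm⟩
  obtain ⟨e, heT, heS⟩ := not_disjoint_iff.1 (htrans _ (mem_image_of_mem _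
    (mem_powersetCard_univ.2 hS)))
  exact ⟨e, heT, (mem_powersetCard.1 heS).1⟩

end Existence

section Codegree

variable {α : Type*} {F : Hypergraph α} {r : ℕ} {c ρ : ℝ}

/-- The edge probability `p = c n ^ (-1 / ρ)` of the random hypergraph on `n` vertices. -/
noncomputable def edgeProb (c ρ : ℝ) (n : ℕ) : ℝ := c * (n : ℝ) ^ (-(1 / ρ))

/-- The contribution `e x ^ (e - 1) / α` of a hypergraph with `e` edges to
`Hypergraph.criticalSum`, where `α` is its `Hypergraph.minStab`. -/
noncomputable def edgeWeight (F : Hypergraph α) (x : ℝ) : ℝ :=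
  F.numEdges * x ^ (F.numEdges - 1) / F.minStab

lemma tendsto_edgeProb (c : ℝ) (hρ : 0 < ρ) : Tendsto (edgeProb c ρ) atTop (𝓝 0) := by
  have hlim := ((tendsto_rpow_neg_atTop (one_div_pos.2 hρ)).comp
    (tendsto_natCast_atTop_atTop (R := ℝ))).const_mul c
  rwa [mul_zero] at hlim

lemma tendsto_natCast_rpow_of_nonpos {b : ℝ} (hb : b ≤ 0) :
    Tendsto (fun n : ℕ ↦ (n : ℝ) ^ b) atTop (𝓝 (if b = 0 then 1 else 0)) := by
  split_ifs with h
  · simp only [h, Real.rpow_zero, tendsto_const_nhds_iff]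
  · simpa only [neg_neg, Function.comp_def] using
      (tendsto_rpow_neg_atTop (neg_pos.2 (lt_of_le_of_ne hb h))).comp
        (tendsto_natCast_atTop_atTop (R := ℝ))

lemma codegreeBound_mul_edgeProb_pow (hv : r < F.numVerts) (he : 0 < F.numEdges) {n : ℕ}
    (hn : 0 < n) :
    codegreeBound r F n * edgeProb c ρ n ^ (F.numEdges - 1) =
      r.factorial * edgeWeight F c *
        (n : ℝ) ^ (((F.numVerts : ℝ) - r) * (1 - F.density r / ρ)) := by
  have hn' : (0 : ℝ) < n := by exact_mod_cast hn
  have hv' : ((F.numVerts : ℝ) - r) ≠ 0 := (sub_pos.2 (by exact_mod_cast hv)).ne'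
  have hpow : (n : ℝ) ^ (((F.numVerts : ℝ) - r) * (1 - F.density r / ρ)) =
      (n : ℝ) ^ (F.numVerts - r) * ((n : ℝ) ^ (-(1 / ρ))) ^ (F.numEdges - 1) := by
    rw [← Real.rpow_natCast, ← Real.rpow_natCast, ← Real.rpow_mul hn'.le, ← Real.rpow_add hn',
      Nat.cast_sub hv.le, Nat.cast_pred he, density]
    congr 1
    field_simp
    ring
  rw [hpow, codegreeBound, edgeWeight, edgeProb, mul_pow]
  ring

lemma tendsto_codegreeBound_mul_edgeProb_pow (hρ : 0 < ρ) (hv : r < F.numVerts)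
    (he : 0 < F.numEdges) (hF : ρ ≤ F.density r) (c : ℝ) :
    Tendsto (fun n ↦ codegreeBound r F n * edgeProb c ρ n ^ (F.numEdges - 1)) atTop
      (𝓝 (if F.density r = ρ then r.factorial * edgeWeight F c else 0)) := by
  have hv' : (0 : ℝ) < F.numVerts - r := sub_pos.2 (by exact_mod_cast hv)
  have hexp : ((F.numVerts : ℝ) - r) * (1 - F.density r / ρ) ≤ 0 :=
    mul_nonpos_of_nonneg_of_nonpos hv'.le (sub_nonpos.2 ((one_le_div hρ).2 hF))
  have hexp_eq : ((F.numVerts : ℝ) - r) * (1 - F.density r / ρ) = 0 ↔ F.density r = ρ := by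
    rw [mul_eq_zero, or_iff_right hv'.ne', sub_eq_zero, eq_comm, div_eq_one_iff_eq hρ.ne']
  have hlim := (tendsto_natCast_rpow_of_nonpos hexp).const_mul (r.factorial * edgeWeight F c)
  simp only [hexp_eq, mul_ite, mul_one, mul_zero] at hlim
  refine hlim.congr' ?_
  filter_upwards [eventually_gt_atTop 0] with n hn
  exact (codegreeBound_mul_edgeProb_pow hv he hn).symm

end Codegree

section Family

variable {ι : Type*} [Fintype ι] {α : ι → Type*} {F : ∀ i, Hypergraph (α i)} {r : ℕ} {c ρ : ℝ}

lemma eventually_sum_codegreeBound_mul_le (hv : ∀ i, r < (F i).numVerts)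
    (he : ∀ i, 0 < (F i).numEdges) (hρ : 0 < ρ) (hF : ∀ i, ρ ≤ (F i).density r) (hc : 0 < c)
    {t : ℝ} (ht : r.factorial * ∑ i with (F i).density r = ρ, edgeWeight (F i) c < t) :
    ∀ᶠ n : ℕ in atTop, ∑ i, codegreeBound r (F i) n *
      (edgeProb c ρ n / (1 - edgeProb c ρ n)) ^ (F i).numEdges ≤ edgeProb c ρ n * t := by
  have hone : Tendsto (fun n ↦ 1 - edgeProb c ρ n) atTop (𝓝 1) := by
    simpa only [sub_zero] using (tendsto_edgeProb c hρ).const_sub 1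
  have hlim : Tendsto (fun n ↦ ∑ i, codegreeBound r (F i) n *
      edgeProb c ρ n ^ ((F i).numEdges - 1) / (1 - edgeProb c ρ n) ^ (F i).numEdges) atTop
      (𝓝 (∑ i, if (F i).density r = ρ then r.factorial * edgeWeight (F i) c else 0)) :=
    tendsto_finsetSum _ fun i _ ↦ by
      simpa only [one_pow, div_one, Pi.div_def] using
        (tendsto_codegreeBound_mul_edgeProb_pow hρ (hv i) (he i) (hF i) c).div
          (hone.pow (F i).numEdges) (pow_ne_zero _ one_ne_zero)
  rw [← sum_filter, ← mul_sum] at hlim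
  filter_upwards [hlim.eventually_lt_const ht, eventually_gt_atTop 0] with n hlt hn
  have hp : 0 < edgeProb c ρ n := mul_pos hc (Real.rpow_pos_of_pos (by exact_mod_cast hn) _)
  refine (Eq.le ?_).trans (mul_le_mul_of_nonneg_left hlt.le hp.le)
  rw [mul_sum]
  refine sum_congr rfl fun i _ ↦ ?_
  rw [div_pow, ← mul_pow_sub_one (he i).ne' (edgeProb c ρ n)]
  ring

end Family

section VertexScale

variable {d : ℕ} {γ K : ℝ}

/-- The solution `x` of `x ^ γ = K k ^ d log k`. In the application, `d` is `r - 1` and `γ` is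
`r - 1 - 1 / ρ`. -/
noncomputable def vertexScale (d : ℕ) (γ K : ℝ) (k : ℕ) : ℝ :=
  (K * ((k : ℝ) ^ d * Real.log k)) ^ (1 / γ)

lemma tendsto_log_natCast_atTop : Tendsto (fun k : ℕ ↦ Real.log k) atTop atTop :=
  Real.tendsto_log_atTop.comp tendsto_natCast_atTop_atTop

lemma vertexScale_pos (hK : 0 < K) {k : ℕ} (hk : 1 < k) : 0 < vertexScale d γ K k := by
  have hlog : 0 < Real.log k := Real.log_pos (by exact_mod_cast hk)
  unfold vertexScale
  positivity

lemma vertexScale_rpow (hK : 0 ≤ K) (k : ℕ) (b : ℝ) :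
    vertexScale d γ K k ^ b = (K * ((k : ℝ) ^ d * Real.log k)) ^ (b / γ) := by
  have := Real.log_natCast_nonneg k
  rw [vertexScale, ← Real.rpow_mul (by positivity), one_div_mul_eq_div]

lemma tendsto_vertexScale_div_atTop (hγ : 0 < γ) (hγd : γ < d) (hK : 0 < K) :
    Tendsto (fun k ↦ vertexScale d γ K k / k) atTop atTop := by
  have hexp : 0 < (d : ℝ) / γ - 1 := by rwa [sub_pos, one_lt_div hγ]
  refine tendsto_atTop_mono' _ ?_ ((tendsto_rpow_atTop hexp).comp tendsto_natCast_atTop_atTop)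
  filter_upwards [eventually_gt_atTop 0, tendsto_log_natCast_atTop.eventually_ge_atTop (1 / K)]
    with k hk hlog
  have hk' : (0 : ℝ) < k := by exact_mod_cast hk
  rw [div_le_iff₀' hK] at hlog
  rw [Function.comp_apply, Real.rpow_sub_one hk'.ne', ← mul_one_div (d : ℝ) γ,
    Real.rpow_mul hk'.le, Real.rpow_natCast]
  refine div_le_div_of_nonneg_right (Real.rpow_le_rpow (by positivity) ?_ (by positivity)) hk'.le
  rw [mul_left_comm]
  exact le_mul_of_one_le_right (by positivity) hlog

lemma tendsto_vertexScale_atTop (hγ : 0 < γ) (hγd : γ < d) (hK : 0 < K) :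
    Tendsto (vertexScale d γ K) atTop atTop := by
  refine tendsto_atTop_mono' _ ?_ (tendsto_vertexScale_div_atTop hγ hγd hK)
  filter_upwards [eventually_gt_atTop 1] with k hk
  exact div_le_self (vertexScale_pos hK hk).le (by exact_mod_cast hk.le)

lemma isLittleO_const_add_log (a : ℝ) : (fun x ↦ a + Real.log x) =o[atTop] (id : ℝ → ℝ) :=
  (isLittleO_const_id_atTop a).add Real.isLittleO_log_id_atTop

lemma eventually_log_vertexScale_le (hγ : 0 < γ) (hK : 0 < K) {t : ℝ} (ht : d / γ < t) :
    ∀ᶠ k : ℕ in atTop, Real.log (vertexScale d γ K k) ≤ t * Real.log k := by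
  rw [div_lt_iff₀ hγ, ← sub_pos] at ht
  filter_upwards [eventually_gt_atTop 1, tendsto_log_natCast_atTop.eventually
    ((isLittleO_const_add_log (Real.log K)).bound ht)] with k hk hle
  have hlog : 0 < Real.log k := Real.log_pos (by exact_mod_cast hk)
  rw [id, Real.norm_of_nonneg hlog.le] at hle
  have : (0 : ℝ) < k := by exact_mod_cast one_pos.trans hk
  rw [vertexScale, Real.log_rpow (by positivity), Real.log_mul hK.ne' (by positivity),
    Real.log_mul (by positivity) hlog.ne', Real.log_pow, one_div_mul_eq_div, div_le_iff₀ hγ]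
  linarith [le_of_abs_le hle]

lemma vertexScale_rpow_mul_pow (hγ : γ ≠ 0) (hK : 0 < K) {k : ℕ} (hk : 1 < k) :
    vertexScale d γ K k ^ (γ - d) * (vertexScale d γ K k / k) ^ (d + 1) =
      K * Real.log k * (vertexScale d γ K k / k) := by
  have : (0 : ℝ) < k := by exact_mod_cast one_pos.trans hk
  have hx := vertexScale_pos (d := d) (γ := γ) hK hk
  have hγx : vertexScale d γ K k ^ γ = K * ((k : ℝ) ^ d * Real.log k) := by
    rw [vertexScale_rpow hK.le, div_self hγ, Real.rpow_one]
  rw [Real.rpow_sub hx, Real.rpow_natCast, hγx, pow_succ, div_pow]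
  field_simp

end VertexScale

lemma eventually_le_choose_floor (r : ℕ) :
    ∀ᶠ y : ℝ in atTop, y ^ r / (2 * r.factorial) ≤ (⌊y⌋₊.choose r : ℝ) := by
  have hfloor : (fun y : ℝ ↦ (⌊y⌋₊.choose r : ℝ)) ~[atTop] fun y ↦ y ^ r / r.factorial :=
    ((isEquivalent_choose r).comp_tendsto tendsto_nat_floor_atTop).trans
      ((isEquivalent_nat_floor.pow r).div IsEquivalent.refl)
  filter_upwards [hfloor.isLittleO.bound one_half_pos, eventually_ge_atTop 0] with y hy hy0
  have hpos : 0 ≤ y ^ r / (r.factorial : ℝ) := by positivity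
  rw [Real.norm_of_nonneg hpos] at hy
  rw [mul_comm, ← div_div]
  have := neg_le_of_abs_le hy
  simp only [Pi.sub_apply] at this
  linarith

section Parameters

variable {r : ℕ} {ρ c₁ c₂ : ℝ}

/-- The constant `K` in the number of vertices `(K k ^ (r - 1) log k) ^ (1 / (r - 1 - 1 / ρ))`. -/
noncomputable def scaleConst (r : ℕ) (ρ c₁ c₂ : ℝ) : ℝ :=
  1 / 2 * (r.factorial / c₁ * c₂ ^ ((r : ℝ) - 1) * (((r : ℝ) - 1) / (r - 1 - 1 / ρ)))

/-- The random hypergraph has `⌊randomScale r ρ c₁ c₂ k⌋₊` vertices. -/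
noncomputable def randomScale (r : ℕ) (ρ c₁ c₂ : ℝ) (k : ℕ) : ℝ :=
  vertexScale (r - 1) (r - 1 - 1 / ρ) (scaleConst r ρ c₁ c₂) k

lemma cast_sub_one_pos (hr : 2 ≤ r) : (0 : ℝ) < r - 1 :=
  sub_pos.2 (by exact_mod_cast hr)

lemma pos_of_one_div_sub_one_lt (hr : 2 ≤ r) (hρ : 1 / ((r : ℝ) - 1) < ρ) : 0 < ρ :=
  (one_div_pos.2 (cast_sub_one_pos hr)).trans hρ

lemma sub_one_sub_one_div_pos (hr : 2 ≤ r) (hρ : 1 / ((r : ℝ) - 1) < ρ) :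
    0 < (r : ℝ) - 1 - 1 / ρ :=
  sub_pos.2 ((one_div_lt (pos_of_one_div_sub_one_lt hr hρ) (cast_sub_one_pos hr)).2 hρ)

lemma scaleConst_pos (hr : 2 ≤ r) (hρ : 1 / ((r : ℝ) - 1) < ρ) (hc₁ : 0 < c₁) (hc₂ : 0 < c₂) :
    0 < scaleConst r ρ c₁ c₂ := by
  have := cast_sub_one_pos hr
  have := sub_one_sub_one_div_pos hr hρ
  unfold scaleConst
  positivity

lemma sub_one_sub_one_div_lt (hr : 2 ≤ r) (hρ : 1 / ((r : ℝ) - 1) < ρ) :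
    (r : ℝ) - 1 - 1 / ρ < (r - 1 : ℕ) := by
  rw [Nat.cast_pred (by omega)]
  exact sub_lt_self _ (one_div_pos.2 (pos_of_one_div_sub_one_lt hr hρ))

lemma two_rpow_mul_inv_mul_half_rpow {A M e : ℝ} (hA : 0 < A) (hM : 0 ≤ M) :
    2 ^ (1 + e) * (A⁻¹ * (1 / 2 * (A * M)) ^ (1 + e)) = A ^ e * M ^ (1 + e) := by
  have htwo : (2 : ℝ) ^ (1 + e) * (1 / 2) ^ (1 + e) = 1 := by
    rw [← Real.mul_rpow two_pos.le one_half_pos.le, mul_one_div_cancel two_ne_zero, Real.one_rpow]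
  rw [Real.mul_rpow one_half_pos.le (by positivity), Real.mul_rpow hA.le hM, Real.rpow_add hA,
    Real.rpow_one]
  linear_combination (A⁻¹ * A * A ^ e * M ^ (1 + e)) * htwo +
    A ^ e * M ^ (1 + e) * inv_mul_cancel₀ hA.ne'

lemma edgeBound_eq_mul (hr : 2 ≤ r) (hρ : 1 / ((r : ℝ) - 1) < ρ) (hc₁ : 0 < c₁) (hc₂ : 0 < c₂)
    (C : ℝ) (k : ℕ) :
    edgeBound C r ρ c₁ c₂ k = C * (2 ^ (1 + 1 / ((r : ℝ) - 1 - 1 / ρ)) *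
      (c₁ / r.factorial * randomScale r ρ c₁ c₂ k ^ ((r : ℝ) - 1 / ρ))) := by
  have hr1 := cast_sub_one_pos hr
  have hγ := sub_one_sub_one_div_pos hr hρ
  have := Real.log_natCast_nonneg k
  have hB : 0 < c₂ ^ ((r : ℝ) - 1) := Real.rpow_pos_of_pos hc₂ _
  rw [randomScale, vertexScale_rpow (scaleConst_pos hr hρ hc₁ hc₂).le, scaleConst, edgeBound,
    mul_div_assoc ((r : ℝ) - 1) _ ((r : ℝ) - 1 - 1 / ρ), Real.rpow_mul hc₂.le,
    show ((r : ℝ) - 1 / ρ) = (r - 1 - 1 / ρ) + 1 by ring, add_div _ 1, div_self hγ.ne']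
  generalize (r : ℝ) - 1 - 1 / ρ = γ at *
  rw [← inv_div (r.factorial : ℝ) c₁, mul_assoc (1 / 2 : ℝ), mul_assoc (r.factorial / c₁ : ℝ),
    mul_assoc (r.factorial / c₁ : ℝ),
    two_rpow_mul_inv_mul_half_rpow (by positivity) (by positivity),
    Real.mul_rpow (mul_nonneg hB.le (by positivity)) (by positivity),
    Real.mul_rpow hB.le (by positivity)]
  ring

lemma two_mul_edgeProb_mul_pow_le_edgeBound (hr : 2 ≤ r) (hρ : 1 / ((r : ℝ) - 1) < ρ)
    (hc₁ : 0 < c₁) (hc₂ : 0 < c₂) {n k : ℕ} (hn : 0 < n) (hnk : n ≤ randomScale r ρ c₁ c₂ k) :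
    2 * (edgeProb c₁ ρ n * ((n : ℝ) ^ r / r.factorial)) ≤ edgeBound 1 r ρ c₁ c₂ k := by
  have hγ := sub_one_sub_one_div_pos hr hρ
  have hn' : (0 : ℝ) < n := by exact_mod_cast hn
  have hexp : (0 : ℝ) ≤ r - 1 / ρ := by linarith
  have htwo : (2 : ℝ) ≤ 2 ^ (1 + 1 / ((r : ℝ) - 1 - 1 / ρ)) :=
    Real.self_le_rpow_of_one_le one_le_two (le_add_of_nonneg_right (one_div_pos.2 hγ).le)
  have hedges : edgeProb c₁ ρ n * ((n : ℝ) ^ r / r.factorial) =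
      c₁ / r.factorial * (n : ℝ) ^ ((r : ℝ) - 1 / ρ) := by
    rw [edgeProb, sub_eq_neg_add, Real.rpow_add hn', Real.rpow_natCast]
    ring
  rw [hedges, edgeBound_eq_mul hr hρ hc₁ hc₂, one_mul]
  gcongr

lemma eventually_two_mul_mul_log_le (hr : 2 ≤ r) (hρ : 1 / ((r : ℝ) - 1) < ρ)
    (hc₁ : 0 < c₁) (hc₂ : 0 < c₂) (hB : 10 ≤ c₂ ^ ((r : ℝ) - 1)) :
    ∀ᶠ k : ℕ in atTop,
      2 * (randomScale r ρ c₁ c₂ k / k * Real.log (randomScale r ρ c₁ c₂ k)) ≤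
        c₁ * randomScale r ρ c₁ c₂ k ^ (-(1 / ρ)) *
          ((randomScale r ρ c₁ c₂ k / k) ^ r / (2 * r.factorial)) := by
  have hr1 := cast_sub_one_pos hr
  have hγ := sub_one_sub_one_div_pos hr hρ
  have hK := scaleConst_pos hr hρ hc₁ hc₂
  have ht : ((r - 1 : ℕ) : ℝ) / (r - 1 - 1 / ρ) < 5 / 4 * (((r : ℝ) - 1) / (r - 1 - 1 / ρ)) := by
    rw [Nat.cast_pred (by omega)]
    linarith [div_pos hr1 hγ]
  filter_upwards [eventually_log_vertexScale_le hγ hK ht, eventually_gt_atTop 1] with k hlogx hk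
  have hscale := vertexScale_rpow_mul_pow (d := r - 1) hγ.ne' hK hk
  have hlog : 0 < Real.log k := Real.log_pos (by exact_mod_cast hk)
  have hk' : (0 : ℝ) < k := by exact_mod_cast one_pos.trans hk
  rw [Nat.sub_add_cancel (by omega), Nat.cast_pred (by omega), sub_sub_cancel_left] at hscale
  have hx : 0 < randomScale r ρ c₁ c₂ k := vertexScale_pos hK hk
  rw [← randomScale] at hscale hlogx
  generalize randomScale r ρ c₁ c₂ k = x at *
  calc 2 * (x / k * Real.log x)
      ≤ 10 / 4 * (((r : ℝ) - 1) / (r - 1 - 1 / ρ) * Real.log k * (x / k)) := by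
        linarith [mul_le_mul_of_nonneg_left hlogx (div_pos hx hk').le]
    _ ≤ c₂ ^ ((r : ℝ) - 1) / 4 * (((r : ℝ) - 1) / (r - 1 - 1 / ρ) * Real.log k * (x / k)) := by
        gcongr
    _ = c₁ * (scaleConst r ρ c₁ c₂ * Real.log k * (x / k)) / (2 * r.factorial) := by
        rw [scaleConst]
        field_simp
        norm_num
    _ = c₁ * x ^ (-(1 / ρ)) * ((x / k) ^ r / (2 * r.factorial)) := by
        rw [← hscale]
        ring

lemma eventually_two_mul_mul_log_le_edgeProb_mul_choose (hr : 2 ≤ r)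
    (hρ : 1 / ((r : ℝ) - 1) < ρ) (hc₁ : 0 < c₁) (hc₂ : 0 < c₂) (hB : 10 ≤ c₂ ^ ((r : ℝ) - 1)) :
    ∀ᶠ k : ℕ in atTop,
      2 * (⌊randomScale r ρ c₁ c₂ k / k⌋₊ * Real.log ⌊randomScale r ρ c₁ c₂ k⌋₊) ≤
        edgeProb c₁ ρ ⌊randomScale r ρ c₁ c₂ k⌋₊ *
          ⌊randomScale r ρ c₁ c₂ k / k⌋₊.choose r := by
  have hγ := sub_one_sub_one_div_pos hr hρ
  have hγr := sub_one_sub_one_div_lt hr hρ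
  have hK := scaleConst_pos hr hρ hc₁ hc₂
  have hρ0 := pos_of_one_div_sub_one_lt hr hρ
  filter_upwards [eventually_two_mul_mul_log_le hr hρ hc₁ hc₂ hB,
    (tendsto_vertexScale_div_atTop hγ hγr hK).eventually (eventually_le_choose_floor r),
    (tendsto_vertexScale_atTop hγ hγr hK).eventually_ge_atTop 1] with k hmain hchoose hx
  rw [← randomScale] at hchoose hx
  generalize randomScale r ρ c₁ c₂ k = x at *
  have hn : (1 : ℝ) ≤ ⌊x⌋₊ := by exact_mod_cast (Nat.one_le_floor_iff x).2 hx
  have hnx : (⌊x⌋₊ : ℝ) ≤ x := Nat.floor_le (by linarith)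
  have hprob : c₁ * x ^ (-(1 / ρ)) ≤ edgeProb c₁ ρ ⌊x⌋₊ :=
    mul_le_mul_of_nonneg_left (Real.rpow_le_rpow_of_nonpos (by linarith) hnx
      (neg_nonpos.2 (one_div_pos.2 hρ0).le)) hc₁.le
  calc 2 * (⌊x / k⌋₊ * Real.log ⌊x⌋₊) ≤ 2 * (x / k * Real.log x) := by
        have := Real.log_nonneg hn
        gcongr
        exact Nat.floor_le (by positivity)
    _ ≤ c₁ * x ^ (-(1 / ρ)) * ((x / k) ^ r / (2 * r.factorial)) := hmain
    _ ≤ edgeProb c₁ ρ ⌊x⌋₊ * ⌊x / k⌋₊.choose r := by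
        exact mul_le_mul hprob hchoose (by positivity) (hprob.trans' (by positivity))

end Parameters

lemma choose_mul_one_sub_pow_mul_exp_lt {n s N : ℕ} {p T : ℝ} (hn : 0 < n) (hp : p ≤ 1)
    (hs : 2 ≤ s * Real.log n) (hN : 2 * (s * Real.log n) ≤ p * N) (hT : T ≤ p * (1 / 10)) :
    n.choose s * ((1 - p) ^ N * Real.exp (N * T)) < 1 / 2 := by
  have hchoose : (n.choose s : ℝ) ≤ Real.exp (s * Real.log n) := by
    rw [mul_comm, Real.exp_mul, Real.exp_log (by exact_mod_cast hn), Real.rpow_natCast]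
    exact_mod_cast Nat.choose_le_pow n s
  have hpow : (1 - p) ^ N ≤ Real.exp (N * -p) := by
    rw [Real.exp_nat_mul]
    exact pow_le_pow_left₀ (sub_nonneg.2 hp) (Real.one_sub_le_exp_neg p) N
  have hexp : (s : ℝ) * Real.log n + (N * -p + N * T) ≤ -1 := by
    linarith [mul_le_mul_of_nonneg_left hT (Nat.cast_nonneg (α := ℝ) N)]
  calc n.choose s * ((1 - p) ^ N * Real.exp (N * T))
      ≤ Real.exp (s * Real.log n) * (Real.exp (N * -p) * Real.exp (N * T)) := by gcongr
    _ ≤ Real.exp (-1) := by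
        rw [← Real.exp_add, ← Real.exp_add]
        exact Real.exp_le_exp.2 hexp
    _ < 1 / 2 := Real.exp_neg_one_lt_half

section Family

variable {ι : Type*} {α : ι → Type*} {F : ∀ i, Hypergraph (α i)} {r : ℕ}

lemma exists_mem_edgeCounts_lt_two_mul [Fintype ι] (hfin : ∀ i, (F i).vertexSet.Finite)
    (hunif : ∀ i, (F i).IsUniform r) (hne : ∀ i, (F i).edgeSet.Nonempty) {n s k : ℕ} (hn : 0 < n)
    (hks : k * s ≤ n) {p : ℝ} (hp₀ : 0 < p) (hp₁ : p < 1) (hs : 2 ≤ s * Real.log n)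
    (hsp : 2 * (s * Real.log n) ≤ p * s.choose r)
    (hF : ∑ i, codegreeBound r (F i) n * (p / (1 - p)) ^ (F i).numEdges ≤ p * (1 / 10)) :
    ∃ x ∈ edgeCounts r F k, (x : ℝ) < 2 * (p * ((n : ℝ) ^ r / r.factorial)) := by
  have : (0 : ℝ) < n := by exact_mod_cast hn
  have hm : 0 < 2 * (p * ((n : ℝ) ^ r / r.factorial)) := by positivity
  have hedges : p * n.choose r / (2 * (p * ((n : ℝ) ^ r / r.factorial))) ≤ 1 / 2 := by
    rw [div_le_iff₀ hm]
    linarith [mul_le_mul_of_nonneg_left (Nat.choose_le_pow_div (α := ℝ) r n) hp₀.le]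
  refine exists_mem_edgeCounts_lt hfin hunif hne hn hks (p := ⟨p, hp₀.le, hp₁.le⟩)
    (Subtype.coe_lt_coe.1 hp₁) hm ?_
  linarith [choose_mul_one_sub_pow_mul_exp_lt hn hp₁.le hs hsp hF]

theorem eventually_exists_mem_edgeCounts_lt [Fintype ι] {ρ c₁ c₂ : ℝ} (hr : 2 ≤ r)
    (hfin : ∀ i, (F i).vertexSet.Finite) (hunif : ∀ i, (F i).IsUniform r)
    (hne : ∀ i, (F i).edgeSet.Nonempty) (hv : ∀ i, r < (F i).numVerts)
    (hρ : 1 / ((r : ℝ) - 1) < ρ) (hF : ∀ i, ρ ≤ (F i).density r) (hc₁ : 0 < c₁)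
    (hsum : r.factorial * ∑ i with (F i).density r = ρ, edgeWeight (F i) c₁ < 1 / 10)
    (hc₂ : 0 < c₂) (hB : 10 ≤ c₂ ^ ((r : ℝ) - 1)) :
    ∀ᶠ k : ℕ in atTop, ∃ x ∈ edgeCounts r F k, (x : ℝ) < edgeBound 1 r ρ c₁ c₂ k := by
  have hγ := sub_one_sub_one_div_pos hr hρ
  have hγr := sub_one_sub_one_div_lt hr hρ
  have hK := scaleConst_pos hr hρ hc₁ hc₂
  have hρ₀ := pos_of_one_div_sub_one_lt hr hρ
  have he : ∀ i, 0 < (F i).numEdges := fun i ↦ (Set.ncard_pos (finite_edgeSet (hfin i))).2 (hne i)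
  have hn : Tendsto (fun k ↦ ⌊randomScale r ρ c₁ c₂ k⌋₊) atTop atTop :=
    tendsto_nat_floor_atTop.comp (tendsto_vertexScale_atTop hγ hγr hK)
  have hs : Tendsto (fun k : ℕ ↦ ⌊randomScale r ρ c₁ c₂ k / k⌋₊) atTop atTop :=
    tendsto_nat_floor_atTop.comp (tendsto_vertexScale_div_atTop hγ hγr hK)
  filter_upwards [hn.eventually (eventually_sum_codegreeBound_mul_le hv he hρ₀ hF hc₁ hsum),
    hn.eventually ((tendsto_edgeProb c₁ hρ₀).eventually_lt_const one_pos),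
    (tendsto_log_natCast_atTop.comp hn).eventually_ge_atTop 2, hn.eventually_gt_atTop 0,
    hs.eventually_ge_atTop 1, eventually_two_mul_mul_log_le_edgeProb_mul_choose hr hρ hc₁ hc₂ hB]
    with k hcodeg hp hlog hn₀ hs₁ hchoose
  have hp₀ : 0 < edgeProb c₁ ρ ⌊randomScale r ρ c₁ c₂ k⌋₊ :=
    mul_pos hc₁ (Real.rpow_pos_of_pos (by exact_mod_cast hn₀) _)
  have hks : k * ⌊randomScale r ρ c₁ c₂ k / k⌋₊ ≤ ⌊randomScale r ρ c₁ c₂ k⌋₊ := by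
    rw [Nat.floor_div_natCast]
    exact Nat.mul_div_le _ k
  have hslog : 2 ≤ ⌊randomScale r ρ c₁ c₂ k / k⌋₊ * Real.log ⌊randomScale r ρ c₁ c₂ k⌋₊ :=
    hlog.trans (le_mul_of_one_le_left (zero_le_two.trans hlog) (by exact_mod_cast hs₁))
  obtain ⟨x, hx, hlt⟩ := exists_mem_edgeCounts_lt_two_mul hfin hunif hne hn₀ hks hp₀ hp hslog
    hchoose hcodeg
  exact ⟨x, hx, hlt.trans_le (two_mul_edgeProb_mul_pow_le_edgeBound hr hρ hc₁ hc₂ hn₀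
    (Nat.floor_le (Nat.pos_of_floor_pos hn₀).le))⟩

end Family

lemma exists_pos_forall_sum_mul_pow_eq_iff {ι : Type*} {s : Finset ι} (hs : s.Nonempty)
    {a : ι → ℝ} {d : ι → ℕ} (ha : ∀ i ∈ s, 0 < a i) (hd : ∀ i ∈ s, d i ≠ 0) {t : ℝ} (ht : 0 < t) :
    ∃ c : ℝ, 0 < c ∧ ∀ x : ℝ, 0 < x → (∑ i ∈ s, a i * x ^ d i = t ↔ x = c) := by
  have hmono : StrictMonoOn (fun x : ℝ ↦ ∑ i ∈ s, a i * x ^ d i) (Set.Ici 0) :=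
    fun x hx y _ hxy ↦ sum_lt_sum_of_nonempty hs fun i hi ↦
      mul_lt_mul_of_pos_left (pow_lt_pow_left₀ hxy hx (hd i hi)) (ha i hi)
  have hzero : ∑ i ∈ s, a i * (0 : ℝ) ^ d i = 0 :=
    sum_eq_zero fun i hi ↦ by rw [zero_pow (hd i hi), mul_zero]
  have htop : Tendsto (fun x : ℝ ↦ ∑ i ∈ s, a i * x ^ d i) atTop atTop := by
    obtain ⟨j, hj⟩ := hs
    refine tendsto_atTop_mono' _ ?_ ((tendsto_pow_atTop (hd j hj)).const_mul_atTop (ha j hj))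
    filter_upwards [eventually_ge_atTop 0] with x hx
    exact single_le_sum (f := fun i ↦ a i * x ^ d i)
      (fun i hi ↦ mul_nonneg (ha i hi).le (pow_nonneg hx _)) hj
  obtain ⟨b, hb, hb₀⟩ := ((htop.eventually_ge_atTop t).and (eventually_ge_atTop 0)).exists
  obtain ⟨c, hc, hct⟩ := intermediate_value_Icc hb₀ (f := fun x : ℝ ↦ ∑ i ∈ s, a i * x ^ d i)
    (by fun_prop) ⟨hzero.trans_le ht.le, hb⟩
  have hc₀ : 0 < c := hc.1.lt_of_ne (by rintro rfl; exact ht.ne (hzero.symm.trans hct))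
  exact ⟨c, hc₀, fun x hx ↦ ⟨fun h ↦ hmono.injOn hx.le hc₀.le (h.trans hct.symm), (· ▸ hct)⟩⟩

section Subhypergraph

variable {α : Type*} {H H' : Hypergraph α} {r : ℕ}

lemma two_le_numEdges (hfin : H.vertexSet.Finite) (hH : H.Nontrivial) : 2 ≤ H.numEdges :=
  (Set.one_lt_ncard (finite_edgeSet hfin)).2 hH

lemma lt_numVerts (hfin : H.vertexSet.Finite) (hunif : H.IsUniform r) (hH : H.Nontrivial) :
    r < H.numVerts := by
  by_contra! hle
  have hall : ∀ e ∈ H.edgeSet, e = H.vertexSet := fun e he ↦ by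
    refine Set.eq_of_subset_of_ncard_le (H.subset_vertexSet_of_mem_edgeSet he) ?_ hfin
    rwa [Set.ncard_def e, hunif e he, ENat.toNat_natCast]
  obtain ⟨e, he, e', he', hne⟩ := hH
  exact hne ((hall e he).trans (hall e' he').symm)

lemma isUniform_of_isSub (h : H'.IsSub H) (hH : H.IsUniform r) : H'.IsUniform r :=
  fun e he ↦ hH e (h.2 he)

lemma exists_isSub_density_eq_rho (hfin : H.vertexSet.Finite) (hH : H.Nontrivial) (r : ℕ) :
    ∃ H' : Hypergraph α, H'.IsSub H ∧ H'.Nontrivial ∧ H'.density r = H.rho r := by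
  let densities : Set ℝ :=
    {x | ∃ H' : Hypergraph α, H'.IsSub H ∧ H'.Nontrivial ∧ x = H'.density r}
  have hne : densities.Nonempty := ⟨_, H, ⟨Set.Subset.rfl, Set.Subset.rfl⟩, hH, rfl⟩
  have hfinite : densities.Finite := by
    refine ((Set.finite_Iic H.numEdges).image2 (fun e v : ℕ ↦ ((e : ℝ) - 1) / (v - r))
      (Set.finite_Iic H.numVerts)).subset ?_
    rintro _ ⟨H', hsub, -, rfl⟩
    exact Set.mem_image2_of_mem (Set.ncard_le_ncard hsub.2 (finite_edgeSet hfin))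
      (Set.ncard_le_ncard hsub.1 hfin)
  obtain ⟨H', hsub, hH', heq⟩ := hne.csSup_mem hfinite
  exact ⟨H', hsub, hH', heq.symm⟩

lemma contains_of_isSub {β : Type*} {G : Hypergraph β} (h : H'.IsSub H) (hG : G.Contains H) :
    G.Contains H' := by
  obtain ⟨f, hf, hsub⟩ := hG
  exact ⟨f, hf.mono h.1, (Set.image_mono h.1).trans hsub.1, (Set.image_mono h.2).trans hsub.2⟩

end Subhypergraph

section Family

variable {ι : Type*} {α : ι → Type*} {H F : ∀ i, Hypergraph (α i)} {r : ℕ}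

lemma edgeCounts_subset_of_isSub (h : ∀ i, (F i).IsSub (H i)) (k : ℕ) :
    edgeCounts r F k ⊆ edgeCounts r H k := by
  rintro m ⟨n, G, hG, hfree, hχ, hm⟩
  exact ⟨n, G, hG, fun i hi ↦ hfree i (contains_of_isSub (h i) hi), hχ, hm⟩

variable [Fintype ι]

lemma mem_critical {i : ι} : i ∈ critical r H ↔ (H i).rho r = familyRho r H := by
  simp [critical]

lemma critical_nonempty [Nonempty ι] : (critical r H).Nonempty := by
  obtain ⟨i, hi⟩ := exists_eq_ciInf_of_finite (f := fun i ↦ (H i).rho r)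
  exact ⟨i, mem_critical.2 hi⟩

lemma sum_edgeWeight_eq_criticalSum (hdens : ∀ i, (F i).density r = (H i).rho r)
    (hF : ∀ i ∈ critical r H, F i = H i) (x : ℝ) :
    ∑ i with (F i).density r = familyRho r H, edgeWeight (F i) x = criticalSum r H x :=
  sum_congr (by ext i; simp [critical, hdens]) fun i hi ↦ by rw [hF i hi, edgeWeight]

lemma exists_pos_forall_criticalSum_eq_iff [Nonempty ι] (hfin : ∀ i, (H i).vertexSet.Finite)
    (hH : ∀ i, (H i).Nontrivial) {t : ℝ} (ht : 0 < t) :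
    ∃ c : ℝ, 0 < c ∧ ∀ x : ℝ, 0 < x → (criticalSum r H x = t ↔ x = c) := by
  have he i := two_le_numEdges (hfin i) (hH i)
  simp only [criticalSum, mul_div_right_comm]
  refine exists_pos_forall_sum_mul_pow_eq_iff critical_nonempty (fun i _ ↦ div_pos ?_ ?_)
    (fun i _ ↦ Nat.sub_ne_zero_of_lt (he i)) ht
  · exact_mod_cast two_pos.trans_le (he i)
  · exact_mod_cast minStab_pos (hfin i) (hH i).nonempty

/-- The ratio `α / (5 e c ^ (e - 1) r!)`, whose maximum over the critical hypergraphs is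
`c₂ ^ (r - 1)`. -/
noncomputable def stabRatio {β : Type*} (r : ℕ) (F : Hypergraph β) (c : ℝ) : ℝ :=
  F.minStab / (5 * F.numEdges * c ^ (F.numEdges - 1) * r.factorial)

lemma ten_le_stabRatio_of_criticalSum_le (hfin : ∀ i, (H i).vertexSet.Finite)
    (hH : ∀ i, (H i).Nontrivial) {c : ℝ} (hc : 0 < c)
    (hsum : criticalSum r H c ≤ 1 / (50 * r.factorial)) {i : ι} (hi : i ∈ critical r H) :
    10 ≤ stabRatio r (H i) c := by
  have hstab : (0 : ℝ) < (H i).minStab := by exact_mod_cast minStab_pos (hfin i) (hH i).nonempty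
  have he : (0 : ℝ) < (H i).numEdges := by
    exact_mod_cast two_pos.trans_le (two_le_numEdges (hfin i) (hH i))
  have hle : edgeWeight (H i) c ≤ 1 / (50 * r.factorial) :=
    (single_le_sum (f := fun i ↦ edgeWeight (H i) c)
      (fun i _ ↦ by unfold edgeWeight; positivity) hi).trans hsum
  rw [edgeWeight, div_le_div_iff₀ hstab (by positivity)] at hle
  rw [stabRatio, le_div_iff₀ (by positivity)]
  linarith

theorem eventually_exists_mem_edgeCounts_lt_of_balanced {c₁ c₂ : ℝ} (hr : 2 ≤ r)
    (hfin : ∀ i, (H i).vertexSet.Finite) (hunif : ∀ i, (H i).IsUniform r)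
    (hH : ∀ i, (H i).Nontrivial) (hbal : ∀ i ∈ critical r H, (H i).IsBalanced r)
    (hρ : 1 / ((r : ℝ) - 1) < familyRho r H) (hc₁ : 0 < c₁)
    (hsum : r.factorial * criticalSum r H c₁ < 1 / 10) (hc₂ : 0 < c₂)
    (hB : 10 ≤ c₂ ^ ((r : ℝ) - 1)) :
    ∀ᶠ k : ℕ in atTop, ∃ x ∈ edgeCounts r H k,
      (x : ℝ) < edgeBound 1 r (familyRho r H) c₁ c₂ k := by
  have hdensest : ∀ i, ∃ F : Hypergraph (α i), F.IsSub (H i) ∧ F.Nontrivial ∧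
      F.density r = (H i).rho r ∧ (i ∈ critical r H → F = H i) := fun i ↦ by
    by_cases hi : i ∈ critical r H
    · exact ⟨H i, ⟨Set.Subset.rfl, Set.Subset.rfl⟩, hH i, (hbal i hi).symm, fun _ ↦ rfl⟩
    · obtain ⟨F, hsub, hF, hdens⟩ := exists_isSub_density_eq_rho (hfin i) (hH i) r
      exact ⟨F, hsub, hF, hdens, fun h ↦ absurd h hi⟩
  choose F hsub hF hdens hcrit using hdensest
  have hFfin i : (F i).vertexSet.Finite := (hfin i).subset (hsub i).1
  have hFunif i : (F i).IsUniform r := isUniform_of_isSub (hsub i) (hunif i)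
  rw [← sum_edgeWeight_eq_criticalSum hdens hcrit] at hsum
  refine (eventually_exists_mem_edgeCounts_lt hr hFfin hFunif (fun i ↦ (hF i).nonempty)
    (fun i ↦ lt_numVerts (hFfin i) (hFunif i) (hF i)) hρ (fun i ↦ ?_) hc₁ hsum hc₂ hB).mono
    fun k ⟨x, hx, hlt⟩ ↦ ⟨x, edgeCounts_subset_of_isSub hsub k hx, hlt⟩
  rw [hdens i]
  exact ciInf_le (Set.finite_range _).bddBelow i

end Family

lemma edgeBound_one_le {r : ℕ} {ρ c₁ c₂ : ℝ} {k : ℕ} {C : ℝ} (hC : 1 ≤ C)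
    (h : 0 ≤ edgeBound 1 r ρ c₁ c₂ k) : edgeBound 1 r ρ c₁ c₂ k ≤ edgeBound C r ρ c₁ c₂ k := by
  have hmul : edgeBound C r ρ c₁ c₂ k = C * edgeBound 1 r ρ c₁ c₂ k := by
    unfold edgeBound
    ring
  exact hmul ▸ le_mul_of_one_le_left h hC

lemma minEdges_lt_of_mem {ι : Type*} {α : ι → Type*} {H : ∀ i, Hypergraph (α i)} {r k x : ℕ}
    {b : ℝ} (hx : x ∈ edgeCounts r H k) (hlt : (x : ℝ) < b) : (minEdges r H k : ℝ) < b :=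
  (Nat.cast_le.2 (Nat.sInf_le hx)).trans_lt hlt

end FreeHypergraph

theorem theorem2_general {ι : Type*} [Fintype ι] [Nonempty ι] {α : ι → Type*} (r : ℕ)
    (hr : 2 ≤ r) (H : ∀ i, Hypergraph (α i))
    (hfin : ∀ i, (H i).vertexSet.Finite)
    (hunif : ∀ i, (H i).IsUniform r)
    (hnontriv : ∀ i, (H i).Nontrivial)
    (hbal : ∀ i ∈ Hypergraph.critical r H, (H i).IsBalanced r)
    (hrho : 1 / ((r : ℝ) - 1) < Hypergraph.familyRho r H) :
    ∃ c₁ : ℝ, 0 < c₁ ∧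
      (∀ x : ℝ, 0 < x →
        (Hypergraph.criticalSum r H x = 1 / (50 * (r.factorial : ℝ)) ↔ x = c₁)) ∧
      ∃ c₂ : ℝ,
        IsGreatest {y : ℝ | ∃ i ∈ Hypergraph.critical r H,
          y = (((H i).minStab : ℝ) /
            (5 * ((H i).numEdges : ℝ) * c₁ ^ ((H i).numEdges - 1) * (r.factorial : ℝ))) ^
              (1 / ((r : ℝ) - 1))} c₂ ∧
        (10 : ℝ) ^ (1 / ((r : ℝ) - 1)) ≤ c₂ ∧
        ∀ C : ℝ, 1 ≤ C → ∀ᶠ k : ℕ in atTop, (Hypergraph.edgeCounts r H k).Nonempty ∧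
          (Hypergraph.minEdges r H k : ℝ) <
            Hypergraph.edgeBound C r (Hypergraph.familyRho r H) c₁ c₂ k := by
  have hr₁ := FreeHypergraph.cast_sub_one_pos hr
  obtain ⟨c₁, hc₁, huniq⟩ := FreeHypergraph.exists_pos_forall_criticalSum_eq_iff (r := r) hfin
    hnontriv (t := 1 / (50 * (r.factorial : ℝ))) (by positivity)
  have hsum := (huniq c₁ hc₁).2 rfl
  obtain ⟨i, hi, hmax⟩ := (Hypergraph.critical r H).exists_max_image
    (fun i ↦ FreeHypergraph.stabRatio r (H i) c₁ ^ (1 / ((r : ℝ) - 1)))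
    FreeHypergraph.critical_nonempty
  have hten := FreeHypergraph.ten_le_stabRatio_of_criticalSum_le hfin hnontriv hc₁ hsum.le hi
  have hpos := (by norm_num : (0 : ℝ) < 10).trans_le hten
  refine ⟨c₁, hc₁, huniq, _, ⟨⟨i, hi, rfl⟩, by rintro _ ⟨j, hj, rfl⟩; exact hmax j hj⟩,
    Real.rpow_le_rpow (by norm_num) hten (by positivity), fun C hC ↦ ?_⟩
  have hev := FreeHypergraph.eventually_exists_mem_edgeCounts_lt_of_balanced hr hfin hunif
    hnontriv hbal hrho hc₁ (by rw [hsum]; field_simp; norm_num) (Real.rpow_pos_of_pos hpos _)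
    (by rwa [← Real.rpow_mul hpos.le, one_div_mul_cancel hr₁.ne', Real.rpow_one])
  filter_upwards [hev] with k ⟨x, hx, hlt⟩
  exact ⟨⟨x, hx⟩, FreeHypergraph.minEdges_lt_of_mem hx
    (hlt.trans_le (FreeHypergraph.edgeBound_one_le hC ((Nat.cast_nonneg x).trans hlt.le)))⟩

theorem theorem2 {ι : Type*} [Fintype ι] [Nonempty ι] {α : ι → Type*} (r : ℕ) (hr : 2 ≤ r)
    (H : ∀ i, Hypergraph (α i))
    (hfin : ∀ i, (H i).vertexSet.Finite)
    (hunif : ∀ i, (H i).IsUniform r)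
    (hnontriv : ∀ i, (H i).Nontrivial)
    (hbal : ∀ i, (H i).IsBalanced r)
    (hrho : 1 / ((r : ℝ) - 1) < Hypergraph.familyRho r H) :
    ∃ c₁ : ℝ, 0 < c₁ ∧
      (∀ x : ℝ, 0 < x →
        (Hypergraph.criticalSum r H x = 1 / (50 * (r.factorial : ℝ)) ↔ x = c₁)) ∧
      ∃ c₂ : ℝ,
        IsGreatest {y : ℝ | ∃ i ∈ Hypergraph.critical r H,
          y = (((H i).minStab : ℝ) /
            (5 * ((H i).numEdges : ℝ) * c₁ ^ ((H i).numEdges - 1) * (r.factorial : ℝ))) ^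
              (1 / ((r : ℝ) - 1))} c₂ ∧
        (10 : ℝ) ^ (1 / ((r : ℝ) - 1)) ≤ c₂ ∧
        (∀ᶠ k : ℕ in atTop, (Hypergraph.edgeCounts r H k).Nonempty ∧
          (Hypergraph.minEdges r H k : ℝ) <
            Hypergraph.edgeBound 2 r (Hypergraph.familyRho r H) c₁ c₂ k) ∧
        (∀ C : ℝ, 1 < C → ∀ᶠ k : ℕ in atTop,
          (Hypergraph.minEdges r H k : ℝ) <
            Hypergraph.edgeBound C r (Hypergraph.familyRho r H) c₁ c₂ k) := by
  obtain ⟨c₁, hc₁, huniq, c₂, hmax, hten, h⟩ := theorem2_general r hr H hfin hunif hnontriv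
    (fun i _ ↦ hbal i) hrho
  exact ⟨c₁, hc₁, huniq, c₂, hmax, hten, h 2 one_le_two,
    fun C hC ↦ (h C hC.le).mono fun _ hk ↦ hk.2⟩
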